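/- Let $k$ be a field. All modules are right modules; for a finite dimensional $k$-algebra $A$ write $DA=\operatorname{Hom}_k(A,k)$ (an $A$-bimodule), $\operatorname{mod}A$ for the category of finitely generated $A$-modules, regarded as complexes concentrated in degree $0$ in the derived category, and, for an integer $n\ge 0$, $\nu_n^{-1}=\mathbf{R}\mathrm{Hom}_A(DA,-)[n]$. The algebra $A$ is called $n$-representation infinite if $\operatorname{gl.dim}A\le n$ and $\nu_n^{-i}A\in\operatorname{mod}A$ for all $i\ge 0$. Theorem. Let $d\ge 1$, let $A$ be a $d$-representation infinite $k$-algebra and let $e\in A$ be an idempotent such that 1. $eA(1-e)=0$; 2. the injective dimension of $A/(e)$ as an $A$-module is strictly less than $d$, where $(e)=AeA$ is the two-sided ideal generated by $e$; 3. $eAe$ is a semisimple algebra. Then the algebra $A/(e)$ is $(d-1)$-representation infinite. -/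

import Mathlib

open CategoryTheory

universe u

/-! Conventions: `k` is a field, `A` a `k`-algebra. Modules are right modules, i.e. modules over
`Aᵐᵒᵖ`; the regular right module is `A` with `op a • x = x * a`. -/

namespace RepInf

section Dual

variable (k A : Type u) [Field k] [Ring A] [Algebra k A]

/-- The `k`-dual `DA = Hom_k(A, k)`. -/
def DualAlg : Type u := A →ₗ[k] k

noncomputable instance : AddCommGroup (DualAlg k A) := inferInstanceAs (AddCommGroup (A →ₗ[k] k))

variable {k A} in
/-- The value of `f ∈ DA` at `x ∈ A`. -/
noncomputable def DualAlg.eval (f : DualAlg k A) (x : A) : k := (show A →ₗ[k] k from f) x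

variable {k A} in
@[ext] theorem DualAlg.ext {f g : DualAlg k A} (h : ∀ x, f.eval x = g.eval x) : f = g :=
  LinearMap.ext h

/-- The right `A`-module structure of `DA`: `(f · a)(x) = f (a x)`. -/
noncomputable instance : Module Aᵐᵒᵖ (DualAlg k A) where
  smul a f := (show A →ₗ[k] k from f) ∘ₗ LinearMap.mulLeft k a.unop
  one_smul f := DualAlg.ext fun x => congrArg f.eval (one_mul x)
  mul_smul a b f := DualAlg.ext fun x => congrArg f.eval (mul_assoc b.unop a.unop x)
  smul_zero _ := rfl
  smul_add _ _ _ := rfl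
  add_smul a b f := DualAlg.ext fun x =>
    (congrArg f.eval (add_mul a.unop b.unop x)).trans (LinearMap.map_add _ _ _)
  zero_smul f := DualAlg.ext fun x =>
    (congrArg f.eval (zero_mul x)).trans (LinearMap.map_zero _)

variable {k A} in
@[simp] theorem DualAlg.smul_eval (a : Aᵐᵒᵖ) (f : DualAlg k A) (x : A) :
    (a • f).eval x = f.eval (a.unop * x) := rfl

variable {k A} in
@[simp] theorem DualAlg.add_eval (f g : DualAlg k A) (x : A) :
    (f + g).eval x = f.eval x + g.eval x := rfl

variable {k A} in
@[simp] theorem DualAlg.zero_eval (x : A) : (0 : DualAlg k A).eval x = 0 := rfl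

variable {A} in
/-- Left multiplication by `a ∈ A` on the bimodule `DA`, `(a · f)(x) = f (x a)`, as an
endomorphism of the right `A`-module `DA`. -/
noncomputable def DualAlg.leftMul (a : A) : DualAlg k A →ₗ[Aᵐᵒᵖ] DualAlg k A where
  toFun f := (show A →ₗ[k] k from f) ∘ₗ LinearMap.mulRight k a
  map_add' _ _ := rfl
  map_smul' b f := DualAlg.ext fun x => congrArg f.eval (mul_assoc b.unop x a).symm

variable {k A} in
@[simp] theorem DualAlg.leftMul_eval (a : A) (f : DualAlg k A) (x : A) :
    (DualAlg.leftMul k a f).eval x = f.eval (x * a) := rfl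

/-- `Hom_A(DA, M)`, the right `A`-linear maps from `DA` to a right `A`-module `M`. -/
def HomDual (M : Type u) [AddCommGroup M] [Module Aᵐᵒᵖ M] : Type u := DualAlg k A →ₗ[Aᵐᵒᵖ] M

section HomDual

variable (M : Type u) [AddCommGroup M] [Module Aᵐᵒᵖ M]

noncomputable instance : AddCommGroup (HomDual k A M) :=
  inferInstanceAs (AddCommGroup (DualAlg k A →ₗ[Aᵐᵒᵖ] M))

variable {k A M} in
/-- The value of `φ ∈ Hom_A(DA, M)` at `f ∈ DA`. -/
noncomputable def HomDual.eval (φ : HomDual k A M) (f : DualAlg k A) : M :=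
  (show DualAlg k A →ₗ[Aᵐᵒᵖ] M from φ) f

variable {k A M} in
@[ext] theorem HomDual.ext {φ ψ : HomDual k A M} (h : ∀ f, φ.eval f = ψ.eval f) : φ = ψ :=
  LinearMap.ext h

/-- The right `A`-module structure of `Hom_A(DA, M)` coming from the left `A`-module structure
of `DA`: `(φ · a)(f) = φ (a · f)`. -/
noncomputable instance : Module Aᵐᵒᵖ (HomDual k A M) where
  smul a φ := (show DualAlg k A →ₗ[Aᵐᵒᵖ] M from φ) ∘ₗ DualAlg.leftMul k a.unop
  one_smul φ := HomDual.ext fun f => congrArg φ.eval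
    (DualAlg.ext fun x => congrArg f.eval (mul_one x))
  mul_smul a b φ := HomDual.ext fun f => congrArg φ.eval
    (DualAlg.ext fun x => congrArg f.eval (mul_assoc x b.unop a.unop).symm)
  smul_zero _ := rfl
  smul_add _ _ _ := rfl
  add_smul a b φ := HomDual.ext fun f =>
    (congrArg φ.eval (DualAlg.ext fun x =>
      (congrArg f.eval (mul_add x a.unop b.unop)).trans (LinearMap.map_add _ _ _))).trans
      (LinearMap.map_add _ (DualAlg.leftMul k a.unop f) (DualAlg.leftMul k b.unop f))
  zero_smul φ := HomDual.ext fun f =>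
    (congrArg φ.eval (DualAlg.ext fun x =>
      (congrArg f.eval (mul_zero x)).trans (LinearMap.map_zero _))).trans
      (LinearMap.map_zero _)

variable {k A M} in
@[simp] theorem HomDual.smul_eval (a : Aᵐᵒᵖ) (φ : HomDual k A M) (f : DualAlg k A) :
    (a • φ).eval f = φ.eval (DualAlg.leftMul k a.unop f) := rfl

end HomDual

/-- The functor `Hom_A(DA, -) : Mod A ⥤ Mod A` on right `A`-modules. -/
noncomputable def homDualFunctor : ModuleCat.{u} Aᵐᵒᵖ ⥤ ModuleCat.{u} Aᵐᵒᵖ where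
  obj M := ModuleCat.of Aᵐᵒᵖ (HomDual k A M)
  map g := ModuleCat.ofHom
    { toFun := fun φ => g.hom ∘ₗ (show DualAlg k A →ₗ[Aᵐᵒᵖ] _ from φ)
      map_add' := fun φ _ => HomDual.ext fun f => LinearMap.map_add g.hom (φ.eval f) _
      map_smul' := fun _ _ => rfl }

instance : (homDualFunctor k A).Additive where

end Dual

/-- The derived category of a module category exists. -/
noncomputable instance (R : Type u) [Ring R] : HasDerivedCategory (ModuleCat.{u} R) :=
  HasDerivedCategory.standard _

section RepresentationInfinite

variable (k A : Type u) [Field k] [Ring A] [Algebra k A]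

/-- The functor `ν_n⁻¹ = RHom_A(DA, -)[n]` on the bounded below derived category of right
`A`-modules. For `A` of finite dimension and finite global dimension it extends the functor of
that name on `Dᵇ(mod A)`, which is a full subcategory of `D⁺(Mod A)`. -/
noncomputable def nuInv (n : ℕ) :
    DerivedCategory.Plus (ModuleCat.{u} Aᵐᵒᵖ) ⥤ DerivedCategory.Plus (ModuleCat.{u} Aᵐᵒᵖ) :=
  (homDualFunctor k A).rightDerivedFunctorPlus ⋙ shiftFunctor _ (n : ℤ)

/-- The object `ν_n⁻ⁱ A`, where `A` is the regular right module placed in degree `0`. -/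
noncomputable def nuInvPow (n i : ℕ) : DerivedCategory.Plus (ModuleCat.{u} Aᵐᵒᵖ) :=
  (nuInv k A n).obj^[i]
    ((DerivedCategory.Plus.singleFunctor (ModuleCat.{u} Aᵐᵒᵖ) 0).obj (ModuleCat.of Aᵐᵒᵖ A))

variable {A} in
/-- `X` belongs to `mod A`: it is isomorphic to a finitely generated right `A`-module placed
in degree `0`. -/
def IsInMod (X : DerivedCategory.Plus (ModuleCat.{u} Aᵐᵒᵖ)) : Prop :=
  ∃ M : ModuleCat.{u} Aᵐᵒᵖ, Module.Finite Aᵐᵒᵖ M ∧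
    Nonempty (X ≅ (DerivedCategory.Plus.singleFunctor (ModuleCat.{u} Aᵐᵒᵖ) 0).obj M)

/-- `A` is an `n`-representation infinite algebra: a finite dimensional `k`-algebra with
`gl.dim A ≤ n` such that `ν_n⁻ⁱ A ∈ mod A` for all `i ≥ 0`. -/
structure IsRepresentationInfinite (n : ℕ) : Prop where
  finiteDimensional : FiniteDimensional k A
  globalDimension_le : ∀ M : ModuleCat.{u} Aᵐᵒᵖ, projectiveDimension M ≤ n
  nuInvPow_isInMod : ∀ i : ℕ, IsInMod (nuInvPow k A n i)

end RepresentationInfinite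

section IdempotentQuotient

variable {A : Type u} [Ring A]

/-- The quotient algebra `A/(e)` by the two-sided ideal generated by `e`. -/
abbrev IdemQuot (e : A) : Type u := (TwoSidedIdeal.span {e}).ringCon.Quotient

/-- `A/(e)` as a right `A`-module, by restriction along the projection `A → A/(e)`. -/
noncomputable def idemQuotModule (e : A) : ModuleCat.{u} Aᵐᵒᵖ :=
  (ModuleCat.restrictScalars (RingHom.op (TwoSidedIdeal.span {e}).ringCon.mk')).obj
    (ModuleCat.of (IdemQuot e)ᵐᵒᵖ (IdemQuot e))

end IdempotentQuotient

end RepInf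

/-!
The ring `A` is triangular with respect to `e`, so that `(e) = Ae`, and `B = A/(e)` satisfies
`Me = 0` for each right `B`-module `M`. Since `eAe` is semisimple, each right `A`-module `K` with
`Ke = K` is projective (`projective_of_smul_eq_self`). There are no nonzero maps from such a `K` to
a `B`-module, and the kernel `Fe` of `F → F/Fe` is of this kind for free `F`; hence `Ext` between
`B`-modules is the same over `A` and over `B` (`mapExt_restr_bijective`). The bound on the injective
dimension of `B` passes to all finitely generated `B`-modules, by right exactness of the top `Ext`,
and gives `gl.dim B ≤ d - 1` (`hasProjectiveDimensionLT_idemQuot`).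

In terms of modules, all `ν_n⁻ⁱ A` lie in `mod A` when the iterates `Extⁿ(DA, -)ⁱ A` are finitely
generated and `Ext(DA, -)` of them is concentrated in degree `n` (`nuInvPow_isInMod_iff`); a module
is said to stay in `mod A` when its iterates have this concentration property. Two facts drive the induction over the powers of
`ν_{d-1}⁻¹` on `B`.

* In global dimension at most `d`, the kernel of an epimorphism between modules that stay in `mod A`
  stays in `mod A` (`StaysInMod.of_shortExact`).
* `DB` is the direct summand `(1 - e)DA` of `DA`, so that `Extⁿ_B(DB, M) = Extⁿ_A(DB, M)` is the
  quotient of `Extⁿ_A(DA, M)` by its part on which `e` is the identity, and that part is a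
  projective `A`-module (`exists_extDual_comparison`).

The invariant is the existence of a presentation `0 → P → X → M → 0` over `A`, with `P` finitely
generated projective and `X` staying in `mod A` (`IsCovered`); for `M = B` it is
`0 → Ae → A → B → 0`. As `M` has injective dimension less than `d`, the long exact sequence shows
that `Ext_A(DA, M)` is concentrated in degree `d - 1`, and it identifies `X' = Extᵈ⁻¹_A(DA, M)` with the kernel of the epimorphism
`Extᵈ_A(DA, P) → Extᵈ_A(DA, X)`. So `X'` stays in `mod A`, and its quotient
`Extᵈ⁻¹_B(DB, M)` has a presentation of the same form (`IsCovered.step`).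
-/

namespace RepInf

open Abelian Limits

/-! ### `Ext(DA, -)` as a functor to right modules -/

section ExtDual

variable (k A : Type u) [Field k] [Ring A] [Algebra k A]

/-- `DA` as an object of the category of right `A`-modules. -/
noncomputable abbrev dualModule : ModuleCat.{u} Aᵐᵒᵖ := ModuleCat.of Aᵐᵒᵖ (DualAlg k A)

variable {A} in
/-- Left multiplication by `a ∈ A` on `DA`, as a morphism of right modules. -/
noncomputable def leftMulHom (a : A) : dualModule k A ⟶ dualModule k A :=
  ModuleCat.ofHom (DualAlg.leftMul k a)

lemma leftMulHom_one : leftMulHom k (1 : A) = 𝟙 _ := by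
  ext f x
  exact congrArg f.eval (mul_one x)

variable {A} in
lemma leftMulHom_mul (a b : A) : leftMulHom k (a * b) = leftMulHom k b ≫ leftMulHom k a := by
  ext f x
  exact congrArg f.eval (mul_assoc x a b).symm

variable {A} in
lemma leftMulHom_add (a b : A) : leftMulHom k (a + b) = leftMulHom k a + leftMulHom k b := by
  ext f x
  exact (congrArg f.eval (mul_add x a b)).trans (LinearMap.map_add _ _ _)

lemma leftMulHom_zero : leftMulHom k (0 : A) = 0 := by
  ext f x
  exact (congrArg f.eval (mul_zero x)).trans (LinearMap.map_zero _)

variable {A}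

/-- The group `Extⁿ(DA, M)`, a right `A`-module through the left `A`-action on `DA`. -/
def ExtDual (M : ModuleCat.{u} Aᵐᵒᵖ) (n : ℕ) : Type u := Ext (dualModule k A) M n

noncomputable instance (M : ModuleCat.{u} Aᵐᵒᵖ) (n : ℕ) : AddCommGroup (ExtDual k M n) :=
  inferInstanceAs (AddCommGroup (Ext (dualModule k A) M n))

noncomputable instance (M : ModuleCat.{u} Aᵐᵒᵖ) (n : ℕ) : Module Aᵐᵒᵖ (ExtDual k M n) where
  smul a x := (Ext.mk₀ (leftMulHom k a.unop)).comp (show Ext (dualModule k A) M n from x)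
    (zero_add n)
  one_smul x := by
    change (Ext.mk₀ (leftMulHom k (1 : A))).comp (show Ext (dualModule k A) M n from x) _ = x
    rw [leftMulHom_one, Ext.mk₀_id_comp]
  mul_smul a b x := by
    change (Ext.mk₀ (leftMulHom k (b.unop * a.unop))).comp
      (show Ext (dualModule k A) M n from x) _ = (Ext.mk₀ (leftMulHom k a.unop)).comp
      ((Ext.mk₀ (leftMulHom k b.unop)).comp (show Ext (dualModule k A) M n from x) _) _
    rw [leftMulHom_mul, Ext.mk₀_comp_mk₀_assoc]
  smul_zero a := Ext.comp_zero ..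
  smul_add a x y := Ext.comp_add ..
  add_smul a b x := by
    change (Ext.mk₀ (leftMulHom k (a.unop + b.unop))).comp
      (show Ext (dualModule k A) M n from x) _ = _
    rw [leftMulHom_add, Ext.mk₀_add, Ext.add_comp]
    rfl
  zero_smul x := by
    change (Ext.mk₀ (leftMulHom k (0 : A))).comp
      (show Ext (dualModule k A) M n from x) _ = _
    rw [leftMulHom_zero, Ext.mk₀_zero, Ext.zero_comp]
    rfl

/-- Postcomposition with a class in `Ext`, which is linear for the right `A`-module structure. -/
noncomputable def ExtDual.postcomp {M N : ModuleCat.{u} Aᵐᵒᵖ} {n m p : ℕ} (y : Ext M N m)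
    (h : n + m = p) : ExtDual k M n →ₗ[Aᵐᵒᵖ] ExtDual k N p where
  toFun x := Ext.comp (show Ext (dualModule k A) M n from x) y h
  map_add' _ _ := Ext.add_comp ..
  map_smul' a x := Ext.comp_assoc _ _ _ (zero_add n) h (by lia)

/-- The functor `Extⁿ(DA, -)` on right `A`-modules. -/
noncomputable def extDualFunctor (n : ℕ) : ModuleCat.{u} Aᵐᵒᵖ ⥤ ModuleCat.{u} Aᵐᵒᵖ where
  obj M := ModuleCat.of Aᵐᵒᵖ (ExtDual k M n)
  map f := ModuleCat.ofHom (ExtDual.postcomp k (Ext.mk₀ f) (add_zero n))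
  map_id M := by
    ext x
    exact Ext.comp_mk₀_id _
  map_comp f g := by
    ext x
    change Ext.comp (show Ext (dualModule k A) _ n from x) (Ext.mk₀ (f ≫ g)) (add_zero n) =
      Ext.comp (Ext.comp (show Ext (dualModule k A) _ n from x) (Ext.mk₀ f) (add_zero n))
        (Ext.mk₀ g) (add_zero n)
    rw [← Ext.mk₀_comp_mk₀, Ext.comp_assoc_of_second_deg_zero]

instance (n : ℕ) : (extDualFunctor k (A := A) n).Additive where
  map_add {M N f g} := by
    ext x
    change Ext.comp (show Ext (dualModule k A) _ n from x) (Ext.mk₀ (f + g)) (add_zero n) = _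
    rw [Ext.mk₀_add, Ext.comp_add]
    rfl

end ExtDual

/-! ### Cohomology of `RHom(DA, M)` -/

section Cohomology

variable {k A : Type u} [Field k] [Ring A] [Algebra k A]

/-- A cocycle `DA ⟶ Iⁿ` in an injective resolution of `M`, as a class in `Extⁿ(DA, M)`. -/
noncomputable def cocycleClass {M : ModuleCat.{u} Aᵐᵒᵖ} (R : InjectiveResolution M) (n : ℕ)
    (f : dualModule k A ⟶ R.cochainComplex.X n)
    (hf : f ≫ R.cochainComplex.d n ((n : ℤ) + 1) = 0) : Ext (dualModule k A) M n :=
  R.extMk (f ≫ (R.cochainComplexXIso n n rfl).hom) (n + 1) rfl (by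
    rw [R.cochainComplex_d n ((n : ℤ) + 1) n (n + 1) rfl (by simp), ← Category.assoc,
      ← Category.assoc, Preadditive.IsIso.comp_right_eq_zero, Category.assoc] at hf
    simpa using hf)

lemma cocycleClass_eq_zero_iff {M : ModuleCat.{u} Aᵐᵒᵖ} (R : InjectiveResolution M) (n : ℕ)
    (f : dualModule k A ⟶ R.cochainComplex.X n)
    (hf : f ≫ R.cochainComplex.d n ((n : ℤ) + 1) = 0) :
    cocycleClass R n f hf = 0 ↔
      ∃ g : dualModule k A ⟶ R.cochainComplex.X ((n : ℤ) - 1),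
        g ≫ R.cochainComplex.d ((n : ℤ) - 1) n = f := by
  rw [cocycleClass, ← R.extEquivCohomologyClass.apply_eq_iff_eq,
    InjectiveResolution.extEquivCohomologyClass_extMk,
    InjectiveResolution.extEquivCohomologyClass_zero,
    CochainComplex.HomComplex.CohomologyClass.mk_eq_zero_iff,
    CochainComplex.HomComplex.Cocycle.fromSingleMk_mem_coboundaries_iff _ _ _ _ _ ((n : ℤ) - 1)
      (by lia)]
  simp

lemma cocycleClass_surjective {M : ModuleCat.{u} Aᵐᵒᵖ} (R : InjectiveResolution M) (n : ℕ)
    (x : Ext (dualModule k A) M n) : ∃ f hf, cocycleClass R n f hf = x := by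
  obtain ⟨f, hf, rfl⟩ := R.extMk_surjective x (n + 1) rfl
  refine ⟨f ≫ (R.cochainComplexXIso n n rfl).inv, ?_, ?_⟩
  · rw [R.cochainComplex_d n ((n : ℤ) + 1) n (n + 1) rfl (by simp)]
    simp [reassoc_of% hf]
  · simp [cocycleClass]

/-- The complex `Hom(DA, I)` in degrees `n - 1`, `n`, `n + 1`. -/
noncomputable abbrev homDualShortComplex (k : Type u) [Field k] [Algebra k A]
    {M : ModuleCat.{u} Aᵐᵒᵖ} (R : InjectiveResolution M)
    (n : ℤ) : ShortComplex (ModuleCat.{u} Aᵐᵒᵖ) :=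
  (((homDualFunctor k A).mapHomologicalComplex (.up ℤ)).obj R.cochainComplex).sc' (n - 1) n (n + 1)

/-- An element of `Hom(DA, M)` as a morphism of right modules. -/
noncomputable def homOfHomDual {M : ModuleCat.{u} Aᵐᵒᵖ} (φ : HomDual k A M) : dualModule k A ⟶ M :=
  ModuleCat.ofHom (show DualAlg k A →ₗ[Aᵐᵒᵖ] M from φ)

lemma homOfHomDual_comp {M N : ModuleCat.{u} Aᵐᵒᵖ} (φ : HomDual k A M) (g : M ⟶ N) :
    homOfHomDual φ ≫ g = homOfHomDual (((homDualFunctor k A).map g).hom φ) := rfl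

/-- The class in `Extⁿ(DA, M)` of a cocycle of `Hom(DA, I)`, as a linear map. -/
noncomputable def cocycleClassHom {M : ModuleCat.{u} Aᵐᵒᵖ} (R : InjectiveResolution M) (n : ℕ) :
    LinearMap.ker (homDualShortComplex k R n).g.hom →ₗ[Aᵐᵒᵖ] ExtDual k M n where
  toFun φ := cocycleClass R n (homOfHomDual φ.1)
    ((homOfHomDual_comp _ _).trans (congrArg homOfHomDual φ.2))
  map_add' φ ψ := by
    refine Eq.trans ?_ (R.add_extMk _ _ _ _ _ _).symm
    dsimp only [cocycleClass]
    congr 1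
    exact Preadditive.add_comp _ _ _ (homOfHomDual φ.1) (homOfHomDual ψ.1) _
  map_smul' a φ := by
    refine Eq.trans ?_ (R.mk₀_comp_extMk _ _ _ _ _).symm
    dsimp only [cocycleClass]
    congr 1

lemma cocycleClassHom_surjective {M : ModuleCat.{u} Aᵐᵒᵖ} (R : InjectiveResolution M) (n : ℕ) :
    Function.Surjective (cocycleClassHom (k := k) R n) := fun x => by
  obtain ⟨f, hf, rfl⟩ := cocycleClass_surjective R n x
  exact ⟨⟨f.hom, congrArg ModuleCat.Hom.hom hf⟩, rfl⟩

lemma ker_cocycleClassHom {M : ModuleCat.{u} Aᵐᵒᵖ} (R : InjectiveResolution M) (n : ℕ) :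
    LinearMap.ker (cocycleClassHom (k := k) R n) =
      LinearMap.range (homDualShortComplex k R n).moduleCatToCycles := by
  ext φ
  rw [LinearMap.mem_ker, LinearMap.mem_range]
  refine (cocycleClass_eq_zero_iff R n (homOfHomDual φ.1)
    ((homOfHomDual_comp _ _).trans (congrArg homOfHomDual φ.2))).trans ⟨?_, ?_⟩
  · rintro ⟨g, hg⟩
    exact ⟨g.hom, Subtype.ext (congrArg ModuleCat.Hom.hom hg)⟩
  · rintro ⟨ψ, hψ⟩
    exact ⟨homOfHomDual ψ, (homOfHomDual_comp _ _).trans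
      (congrArg homOfHomDual (congrArg Subtype.val hψ))⟩

/-- The cohomology of `Hom(DA, I)` for an injective resolution `I` of `M` is `Ext(DA, M)`. -/
noncomputable def homDualHomologyIso {M : ModuleCat.{u} Aᵐᵒᵖ} (R : InjectiveResolution M)
    (n : ℕ) :
    (((homDualFunctor k A).mapHomologicalComplex (.up ℤ)).obj R.cochainComplex).homology (n : ℤ) ≅
      (extDualFunctor k n).obj M :=
  ShortComplex.homologyMapIso (HomologicalComplex.isoSc' _ ((n : ℤ) - 1) n (n + 1)
    (by simp) (by simp)) ≪≫ (homDualShortComplex k R n).moduleCatHomologyIso ≪≫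
    ((Submodule.quotEquivOfEq _ _ (ker_cocycleClassHom R n).symm).trans
      (LinearMap.quotKerEquivOfSurjective _ (cocycleClassHom_surjective R n))).toModuleIso

/-- An injective resolution as an object of the category of bounded below complexes. -/
noncomputable abbrev injectivePlus {M : ModuleCat.{u} Aᵐᵒᵖ} (R : InjectiveResolution M) :
    CochainComplex.Plus (ModuleCat.{u} Aᵐᵒᵖ) := ⟨R.cochainComplex, 0, inferInstance⟩

/-- A module is isomorphic in the derived category to each of its injective resolutions. -/
noncomputable def singleIsoInjective {M : ModuleCat.{u} Aᵐᵒᵖ} (R : InjectiveResolution M) :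
    (DerivedCategory.Plus.singleFunctor (ModuleCat.{u} Aᵐᵒᵖ) 0).obj M ≅
      DerivedCategory.Plus.Qh.obj ((HomotopyCategory.Plus.quotient _).obj (injectivePlus R)) :=
  let e : DerivedCategory.Q.obj ((CochainComplex.singleFunctor _ 0).obj M) ≅
    DerivedCategory.Q.obj R.cochainComplex := asIso (DerivedCategory.Q.map R.ι')
  DerivedCategory.Plus.ι.preimageIso e

/-- `RHom(DA, M)` is computed by an injective resolution of `M`. -/
noncomputable def rightDerivedIso {M : ModuleCat.{u} Aᵐᵒᵖ} (R : InjectiveResolution M) :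
    (homDualFunctor k A).rightDerivedFunctorPlus.obj
      ((DerivedCategory.Plus.singleFunctor (ModuleCat.{u} Aᵐᵒᵖ) 0).obj M) ≅
    DerivedCategory.Plus.Qh.obj ((homDualFunctor k A).mapHomotopyCategoryPlus.obj
      ((HomotopyCategory.Plus.quotient _).obj (injectivePlus R))) :=
  haveI (n : ℤ) : Injective
      (((HomotopyCategory.Plus.quotient _).obj (injectivePlus R)).obj.as.X n) :=
    inferInstanceAs (Injective (R.cochainComplex.X n))
  (homDualFunctor k A).rightDerivedFunctorPlus.mapIso (singleIsoInjective R) ≪≫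
    (asIso ((homDualFunctor k A).rightDerivedFunctorPlusUnit.app _)).symm

/-- The cohomology of `RHom(DA, M)`, in terms of an injective resolution. -/
noncomputable def homologyRightDerivedIso {M : ModuleCat.{u} Aᵐᵒᵖ} (R : InjectiveResolution M)
    (n : ℤ) :
    (DerivedCategory.Plus.homologyFunctor _ n).obj
      ((homDualFunctor k A).rightDerivedFunctorPlus.obj
        ((DerivedCategory.Plus.singleFunctor (ModuleCat.{u} Aᵐᵒᵖ) 0).obj M)) ≅
    (((homDualFunctor k A).mapHomologicalComplex (.up ℤ)).obj R.cochainComplex).homology n :=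
  (DerivedCategory.Plus.homologyFunctor _ n).mapIso (rightDerivedIso R) ≪≫
    (DerivedCategory.homologyFunctorFactors _ n).app
      (((homDualFunctor k A).mapHomologicalComplex (.up ℤ)).obj R.cochainComplex)

/-- The cohomology of `RHom(DA, M)` in degree `n ≥ 0` is the right module `Extⁿ(DA, M)`. -/
noncomputable def homologyRightDerivedIsoExt (M : ModuleCat.{u} Aᵐᵒᵖ) (n : ℕ) :
    (DerivedCategory.Plus.homologyFunctor _ (n : ℤ)).obj
      ((homDualFunctor k A).rightDerivedFunctorPlus.obj
        ((DerivedCategory.Plus.singleFunctor (ModuleCat.{u} Aᵐᵒᵖ) 0).obj M)) ≅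
    (extDualFunctor k n).obj M :=
  homologyRightDerivedIso (injectiveResolution M) n ≪≫ homDualHomologyIso _ n

lemma isZero_homology_rightDerived (M : ModuleCat.{u} Aᵐᵒᵖ) (n : ℤ) (hn : n < 0) :
    IsZero ((DerivedCategory.Plus.homologyFunctor _ n).obj
      ((homDualFunctor k A).rightDerivedFunctorPlus.obj
        ((DerivedCategory.Plus.singleFunctor (ModuleCat.{u} Aᵐᵒᵖ) 0).obj M))) := by
  refine IsZero.of_iso ?_ (homologyRightDerivedIso (injectiveResolution M) n)
  apply ShortComplex.isZero_homology_of_isZero_X₂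
  exact (homDualFunctor k A).map_isZero (CochainComplex.isZero_of_isStrictlyGE _ 0 n hn)

end Cohomology

/-! ### The functor `ν_n⁻¹` on modules -/

section NuInv

section

variable {C : Type*} [Category* C] [Abelian C] [HasDerivedCategory C]

/-- An object of `D⁺` with cohomology only in degree `0` is a stalk complex. -/
lemma nonempty_iso_single_of_isZero_homology (X : DerivedCategory.Plus C)
    (h : ∀ j : ℤ, j ≠ 0 → IsZero ((DerivedCategory.Plus.homologyFunctor C j).obj X)) :
    Nonempty (X ≅ (DerivedCategory.Plus.singleFunctor C 0).obj
      ((DerivedCategory.Plus.homologyFunctor C 0).obj X)) := by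
  have : (DerivedCategory.Plus.ι.obj X).IsGE 0 :=
    (DerivedCategory.isGE_iff _ _).2 fun i hi => h i hi.ne
  have : (DerivedCategory.Plus.ι.obj X).IsLE 0 :=
    (DerivedCategory.isLE_iff _ _).2 fun i hi => h i hi.ne'
  obtain ⟨Y, ⟨e⟩⟩ :=
    DerivedCategory.exists_iso_singleFunctor_obj_of_isGE_of_isLE (DerivedCategory.Plus.ι.obj X) 0
  let e' : (DerivedCategory.Plus.homologyFunctor C 0).obj X ≅ Y :=
    (DerivedCategory.homologyFunctor C 0).mapIso e ≪≫
      (DerivedCategory.singleFunctorCompHomologyFunctorIso C 0).app Y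
  let e'' : X ≅ (DerivedCategory.Plus.singleFunctor C 0).obj Y :=
    DerivedCategory.Plus.ι.preimageIso e
  exact ⟨e'' ≪≫ (DerivedCategory.Plus.singleFunctor C 0).mapIso e'.symm⟩

/-- The degree `0` cohomology of a stalk complex in degree `0`. -/
noncomputable def homologySingleIso (Y : C) :
    (DerivedCategory.Plus.homologyFunctor C 0).obj
      ((DerivedCategory.Plus.singleFunctor C 0).obj Y) ≅ Y :=
  (DerivedCategory.singleFunctorCompHomologyFunctorIso C 0).app Y

lemma isZero_homology_single (Y : C) (j : ℤ) (hj : j ≠ 0) :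
    IsZero ((DerivedCategory.Plus.homologyFunctor C j).obj
      ((DerivedCategory.Plus.singleFunctor C 0).obj Y)) := by
  rcases lt_or_gt_of_ne hj with h | h
  · exact DerivedCategory.Plus.isZero_homology_of_isGE _ 0 j h
  · exact DerivedCategory.Plus.isZero_homology_of_isLE _ 0 j h

/-- The cohomology of a shifted object. -/
noncomputable def homologyShiftIso (X : DerivedCategory.Plus C) (n j i : ℤ) (h : n + j = i) :
    (DerivedCategory.Plus.homologyFunctor C j).obj ((shiftFunctor _ n).obj X) ≅
      (DerivedCategory.Plus.homologyFunctor C i).obj X :=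
  ((DerivedCategory.Plus.homologyFunctor C 0).shiftIso n j i h).app X

end

variable (k : Type u) {A : Type u} [Field k] [Ring A] [Algebra k A]

/-- `Ext(DA, M)` is concentrated in degree `n`. -/
def ExtConcentrated (n : ℕ) (M : ModuleCat.{u} Aᵐᵒᵖ) : Prop :=
  ∀ j : ℕ, j ≠ n → Subsingleton (Ext (dualModule k A) M j)

lemma isZero_extDualFunctor_iff (M : ModuleCat.{u} Aᵐᵒᵖ) (n : ℕ) :
    IsZero ((extDualFunctor k n).obj M) ↔ Subsingleton (Ext (dualModule k A) M n) :=
  ModuleCat.isZero_iff_subsingleton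

variable {k}

/-- The cohomology of `ν_n⁻¹ M` in degree `j` is `Extⁿ⁺ʲ(DA, M)`. -/
noncomputable def homologyNuInvIso (M : ModuleCat.{u} Aᵐᵒᵖ) (n i : ℕ) (j : ℤ)
    (h : (n : ℤ) + j = i) :
    (DerivedCategory.Plus.homologyFunctor _ j).obj ((nuInv k A n).obj
      ((DerivedCategory.Plus.singleFunctor (ModuleCat.{u} Aᵐᵒᵖ) 0).obj M)) ≅
    (extDualFunctor k i).obj M :=
  homologyShiftIso _ n j i h ≪≫ homologyRightDerivedIsoExt M i

lemma ExtConcentrated.nonempty_nuInv_iso {n : ℕ} {M : ModuleCat.{u} Aᵐᵒᵖ}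
    (h : ExtConcentrated k n M) :
    Nonempty ((nuInv k A n).obj
      ((DerivedCategory.Plus.singleFunctor (ModuleCat.{u} Aᵐᵒᵖ) 0).obj M) ≅
      (DerivedCategory.Plus.singleFunctor (ModuleCat.{u} Aᵐᵒᵖ) 0).obj
        ((extDualFunctor k n).obj M)) := by
  obtain ⟨e⟩ := nonempty_iso_single_of_isZero_homology ((nuInv k A n).obj
      ((DerivedCategory.Plus.singleFunctor (ModuleCat.{u} Aᵐᵒᵖ) 0).obj M)) (fun j hj => by
    rcases lt_or_ge ((n : ℤ) + j) 0 with hlt | hge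
    · exact (isZero_homology_rightDerived M _ hlt).of_iso (homologyShiftIso _ n j _ rfl)
    · obtain ⟨i, hi⟩ := Int.eq_ofNat_of_zero_le hge
      refine IsZero.of_iso ?_ (homologyNuInvIso M n i j hi)
      rw [isZero_extDualFunctor_iff]
      exact h i (by lia))
  exact ⟨e ≪≫ (DerivedCategory.Plus.singleFunctor _ 0).mapIso
    (homologyNuInvIso M n n 0 (by simp))⟩

lemma extConcentrated_of_nuInv_iso {n : ℕ} {M N : ModuleCat.{u} Aᵐᵒᵖ}
    (e : (nuInv k A n).obj
      ((DerivedCategory.Plus.singleFunctor (ModuleCat.{u} Aᵐᵒᵖ) 0).obj M) ≅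
      (DerivedCategory.Plus.singleFunctor (ModuleCat.{u} Aᵐᵒᵖ) 0).obj N) :
    ExtConcentrated k n M ∧ Nonempty ((extDualFunctor k n).obj M ≅ N) := by
  refine ⟨fun j hj => ?_, ⟨(homologyNuInvIso M n n 0 (by simp)).symm ≪≫
    (DerivedCategory.Plus.homologyFunctor _ 0).mapIso e ≪≫ homologySingleIso N⟩⟩
  rw [← isZero_extDualFunctor_iff]
  exact (isZero_homology_single N ((j : ℤ) - n) (by lia)).of_iso
    ((homologyNuInvIso M n j ((j : ℤ) - n) (by lia)).symm ≪≫
      (DerivedCategory.Plus.homologyFunctor _ _).mapIso e)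

variable (k A) in
/-- All powers `ν_n⁻ⁱ A` lie in `mod A` if and only if `Ext(DA, -)` of the iterates
`Extⁿ(DA, -)ⁱ A` is concentrated in degree `n` and these iterates are finitely generated. -/
lemma nuInvPow_isInMod_iff (n : ℕ) :
    (∀ i, IsInMod (nuInvPow k A n i)) ↔ ∀ i : ℕ,
      Module.Finite Aᵐᵒᵖ ((extDualFunctor k n).obj^[i] (ModuleCat.of Aᵐᵒᵖ A)) ∧
      ExtConcentrated k n ((extDualFunctor k n).obj^[i] (ModuleCat.of Aᵐᵒᵖ A)) := by
  have hsucc (i : ℕ) : nuInvPow k A n (i + 1) = (nuInv k A n).obj (nuInvPow k A n i) :=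
    Function.iterate_succ_apply' _ _ _
  have hsucc' (i : ℕ) : (extDualFunctor k n).obj^[i + 1] (ModuleCat.of Aᵐᵒᵖ A) =
      (extDualFunctor k n).obj ((extDualFunctor k n).obj^[i] (ModuleCat.of Aᵐᵒᵖ A)) :=
    Function.iterate_succ_apply' _ _ _
  constructor
  · intro h
    have hiso (i : ℕ) : Nonempty (nuInvPow k A n i ≅
        (DerivedCategory.Plus.singleFunctor _ 0).obj
          ((extDualFunctor k n).obj^[i] (ModuleCat.of Aᵐᵒᵖ A))) := by
      induction i with
      | zero => exact ⟨Iso.refl _⟩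
      | succ i ih =>
        obtain ⟨e⟩ := ih
        obtain ⟨N, -, ⟨e'⟩⟩ := h (i + 1)
        rw [hsucc] at e'
        obtain ⟨-, ⟨e''⟩⟩ := extConcentrated_of_nuInv_iso ((nuInv k A n).mapIso e.symm ≪≫ e')
        rw [hsucc, hsucc']
        exact ⟨e' ≪≫ (DerivedCategory.Plus.singleFunctor _ 0).mapIso e''.symm⟩
    intro i
    obtain ⟨e⟩ := hiso i
    constructor
    · obtain ⟨N, hN, ⟨e'⟩⟩ := h i
      let e'' : N ≅ (extDualFunctor k n).obj^[i] (ModuleCat.of Aᵐᵒᵖ A) :=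
        (homologySingleIso _).symm ≪≫ (DerivedCategory.Plus.homologyFunctor _ 0).mapIso
          (e'.symm ≪≫ e) ≪≫ homologySingleIso _
      exact Module.Finite.equiv e''.toLinearEquiv
    · obtain ⟨N, -, ⟨e'⟩⟩ := h (i + 1)
      rw [hsucc] at e'
      exact (extConcentrated_of_nuInv_iso ((nuInv k A n).mapIso e.symm ≪≫ e')).1
  · intro h
    have hiso (i : ℕ) : Nonempty (nuInvPow k A n i ≅
        (DerivedCategory.Plus.singleFunctor _ 0).obj
          ((extDualFunctor k n).obj^[i] (ModuleCat.of Aᵐᵒᵖ A))) := by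
      induction i with
      | zero => exact ⟨Iso.refl _⟩
      | succ i ih =>
        obtain ⟨e⟩ := ih
        obtain ⟨e'⟩ := (h i).2.nonempty_nuInv_iso
        rw [hsucc, hsucc']
        exact ⟨(nuInv k A n).mapIso e ≪≫ e'⟩
    exact fun i => ⟨_, (h i).1, hiso i⟩

end NuInv

/-! ### Global dimension and finitely generated modules -/

section GlobalDimension

variable {R : Type u} [Ring R]

/-- Baer's criterion in degree `n + 1`. -/
lemma subsingleton_ext_of_cyclic (n : ℕ) (N : ModuleCat.{u} R)
    (h : ∀ I : Ideal R, Subsingleton (Ext (ModuleCat.of R (R ⧸ I)) N (n + 1)))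
    (M : ModuleCat.{u} R) : Subsingleton (Ext M N (n + 1)) := by
  induction n generalizing N with
  | zero =>
    have hB : Module.Baer R N := fun I g => by
      let S : ShortComplex (ModuleCat.{u} R) := I.mkQ.shortComplexKer
      have hS : S.ShortExact := LinearMap.shortExact_shortComplexKer (Submodule.mkQ_surjective I)
      let g' : S.X₁ ⟶ N := ModuleCat.ofHom (g ∘ₗ
        (LinearEquiv.ofEq _ _ (Submodule.ker_mkQ I)).toLinearMap)
      obtain ⟨x, hx⟩ := Ext.contravariant_sequence_exact₁ hS N (Ext.mk₀ g') (n₁ := 1) rfl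
        ((h I).elim _ _)
      obtain ⟨φ, rfl⟩ := (Ext.mk₀_bijective _ _).2 x
      rw [Ext.mk₀_comp_mk₀] at hx
      have hx := (Ext.mk₀_bijective _ _).1 hx
      refine ⟨φ.hom, fun x hxI => ?_⟩
      exact congrArg (fun f : S.X₁ ⟶ N => f.hom ⟨x, (Submodule.ker_mkQ I).symm ▸ hxI⟩) hx
    have : Module.Injective R N := hB.injective
    have : Injective N := Module.injective_object_of_injective_module R N
    exact HasInjectiveDimensionLT.subsingleton N 1 1 le_rfl M
  | succ n ih =>
    let J : InjectivePresentation N := Classical.arbitrary _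
    let S := ShortComplex.mk _ _ (cokernel.condition J.f)
    have hS : S.ShortExact := { exact := ShortComplex.exact_cokernel J.f }
    have : Injective S.X₂ := J.injective
    have h' := ih S.X₃ fun I => ⟨fun a b => by
      rw [← sub_eq_zero]
      obtain ⟨y, hy⟩ := Ext.covariant_sequence_exact₃ _ hS (a - b) (n₁ := n + 2) rfl
        ((h I).elim _ _)
      rw [← hy, Ext.eq_zero_of_injective y, Ext.zero_comp]⟩
    refine subsingleton_of_forall_eq 0 fun x => ?_
    obtain ⟨y, rfl⟩ := Ext.covariant_sequence_exact₁ M hS x (Ext.eq_zero_of_injective _) rfl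
    rw [h'.elim y 0, Ext.zero_comp]

/-- Over a noetherian ring, vanishing of `Extⁿ⁺¹(M, -)` on finitely generated modules bounds the
projective dimension of a finitely generated module `M`. -/
lemma hasProjectiveDimensionLT_of_finite [IsNoetherianRing R] (n : ℕ) (M : ModuleCat.{u} R)
    [Module.Finite R M]
    (h : ∀ N : ModuleCat.{u} R, Module.Finite R N → Subsingleton (Ext M N (n + 1))) :
    HasProjectiveDimensionLT M (n + 1) := by
  induction n generalizing M with
  | zero =>
    obtain ⟨r, f, hf⟩ := Module.Finite.exists_fin' R M
    let S : ShortComplex (ModuleCat.{u} R) := f.shortComplexKer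
    have hS : S.ShortExact := LinearMap.shortExact_shortComplexKer hf
    have : Projective S.X₂ := ModuleCat.projective_of_free (Module.Free.chooseBasis R (Fin r → R))
    -- A presentation with projective middle term splits when its class in `Ext¹` vanishes.
    obtain ⟨x, hx⟩ := Ext.contravariant_sequence_exact₁ hS S.X₁ (Ext.mk₀ (𝟙 S.X₁)) (n₁ := 1) rfl
      ((h S.X₁ (inferInstanceAs (Module.Finite R (LinearMap.ker f)))).elim _ _)
    obtain ⟨φ, rfl⟩ := (Ext.mk₀_bijective _ _).2 x
    rw [Ext.mk₀_comp_mk₀] at hx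
    have hx : S.f ≫ φ = 𝟙 _ := (Ext.mk₀_bijective _ _).1 hx
    let s := ShortComplex.Splitting.ofExactOfRetraction S hS.exact φ hx hS.epi_g
    have : Projective S.X₃ := (Retract.mk s.s S.g s.s_g).projective
    exact inferInstanceAs (HasProjectiveDimensionLT S.X₃ 1)
  | succ n ih =>
    obtain ⟨r, f, hf⟩ := Module.Finite.exists_fin' R M
    let S : ShortComplex (ModuleCat.{u} R) := f.shortComplexKer
    have hS : S.ShortExact := LinearMap.shortExact_shortComplexKer hf
    have : Projective S.X₂ := ModuleCat.projective_of_free (Module.Free.chooseBasis R (Fin r → R))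
    have : Module.Finite R S.X₁ := inferInstanceAs (Module.Finite R (LinearMap.ker f))
    refine hS.hasProjectiveDimensionLT_X₃ (n + 1) ?_ (hasProjectiveDimensionLT_of_ge _ 1 _ (by lia))
    refine ih S.X₁ fun N hN => subsingleton_of_forall_eq 0 fun x => ?_
    obtain ⟨y, rfl⟩ := Ext.contravariant_sequence_exact₁ hS N x (n₁ := n + 2) (by lia)
      ((h N hN).elim _ _)
    rw [Ext.eq_zero_of_projective y, Ext.comp_zero]

/-- Over a noetherian ring, the global dimension is detected by finitely generated modules. -/
lemma hasProjectiveDimensionLT_of_ext_finite [IsNoetherianRing R] (n : ℕ)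
    (h : ∀ M N : ModuleCat.{u} R, Module.Finite R M → Module.Finite R N →
      Subsingleton (Ext M N (n + 1))) (M : ModuleCat.{u} R) :
    HasProjectiveDimensionLT M (n + 1) := by
  refine hasProjectiveDimensionLT_of_enoughInjectives M _ fun N => ?_
  refine subsingleton_ext_of_cyclic n N (fun I => ?_) M
  have := hasProjectiveDimensionLT_of_finite n (ModuleCat.of R (R ⧸ I))
    (fun N hN => h _ N inferInstance hN)
  exact HasProjectiveDimensionLT.subsingleton _ (n + 1) _ le_rfl N

end GlobalDimension

/-! ### Direct summands of finite direct powers -/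

section AddClosure

variable {C D : Type*} [Category* C] [Category* D] [Preadditive C] [Preadditive D]

/-- `Y` is a direct summand of a finite direct power of `X`, expressed by a decomposition of the
identity of `Y` as a finite sum of morphisms that factor through `X`. -/
def InAdd (X Y : C) : Prop :=
  ∃ (r : ℕ) (π : Fin r → (Y ⟶ X)) (σ : Fin r → (X ⟶ Y)), ∑ i, π i ≫ σ i = 𝟙 Y

lemma InAdd.map {X Y : C} (h : InAdd X Y) (F : C ⥤ D) [F.Additive] :
    InAdd (F.obj X) (F.obj Y) := by
  obtain ⟨r, π, σ, h⟩ := h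
  refine ⟨r, fun i => F.map (π i), fun i => F.map (σ i), ?_⟩
  simp only [← F.map_comp, ← F.map_sum, h, F.map_id]

lemma InAdd.iterate {X Y : C} (h : InAdd X Y) (F : C ⥤ C) [F.Additive] (i : ℕ) :
    InAdd (F.obj^[i] X) (F.obj^[i] Y) := by
  induction i with
  | zero => exact h
  | succ i ih =>
    rw [Function.iterate_succ_apply', Function.iterate_succ_apply']
    exact ih.map F

lemma InAdd.isZero [HasZeroObject C] {X Y : C} (h : InAdd X Y) (hX : IsZero X) : IsZero Y := by
  obtain ⟨r, π, σ, h⟩ := h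
  rw [IsZero.iff_id_eq_zero, ← h]
  exact Finset.sum_eq_zero fun i _ => by rw [hX.eq_of_tgt (π i) 0, zero_comp]

lemma InAdd.finite {R : Type u} [Ring R] {X Y : ModuleCat.{u} R} (h : InAdd X Y)
    [Module.Finite R X] : Module.Finite R Y := by
  obtain ⟨r, π, σ, h⟩ := h
  refine Module.Finite.of_surjective (LinearMap.lsum R (fun _ : Fin r => X) ℕ fun i => (σ i).hom)
    fun y => ⟨fun i => (π i).hom y, ?_⟩
  have := congrArg (fun f : Y ⟶ Y => f.hom y) h
  simpa [LinearMap.lsum_apply, ModuleCat.hom_sum] using this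

end AddClosure

/-! ### Modules whose iterated `Extⁿ(DA, -)` stay concentrated in degree `n` -/

section Concentrated

variable (k : Type u) {A : Type u} [Field k] [Ring A] [Algebra k A]

/-- All iterates `ν_n⁻ⁱ M` are modules: `Ext(DA, -)` of each iterate `Extⁿ(DA, -)ⁱ M` is
concentrated in degree `n`. -/
def StaysInMod (n : ℕ) (M : ModuleCat.{u} Aᵐᵒᵖ) : Prop :=
  ∀ i : ℕ, ExtConcentrated k n ((extDualFunctor k n).obj^[i] M)

variable {k}

lemma ExtConcentrated.of_inAdd {n : ℕ} {M N : ModuleCat.{u} Aᵐᵒᵖ} (h : ExtConcentrated k n M)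
    (hN : InAdd M N) : ExtConcentrated k n N := fun j hj => by
  rw [← isZero_extDualFunctor_iff]
  exact (hN.map (extDualFunctor k j)).isZero ((isZero_extDualFunctor_iff k M j).2 (h j hj))

lemma StaysInMod.of_inAdd {n : ℕ} {M N : ModuleCat.{u} Aᵐᵒᵖ} (h : StaysInMod k n M)
    (hN : InAdd M N) : StaysInMod k n N :=
  fun i => (h i).of_inAdd (hN.iterate _ i)

lemma StaysInMod.obj {n : ℕ} {M : ModuleCat.{u} Aᵐᵒᵖ} (h : StaysInMod k n M) :
    StaysInMod k n ((extDualFunctor k n).obj M) := fun i => by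
  rw [← Function.iterate_succ_apply]
  exact h (i + 1)

/-- A piece of the long exact sequence of `Ext(DA, -)`. -/
lemma subsingleton_ext_X₁ (X : ModuleCat.{u} Aᵐᵒᵖ) {S : ShortComplex (ModuleCat.{u} Aᵐᵒᵖ)}
    (hS : S.ShortExact) (j : ℕ)
    (h₃ : Subsingleton (Ext X S.X₃ j)) (h₂ : Subsingleton (Ext X S.X₂ (j + 1))) :
    Subsingleton (Ext X S.X₁ (j + 1)) := by
  refine subsingleton_of_forall_eq 0 fun x => ?_
  obtain ⟨y, rfl⟩ := Ext.covariant_sequence_exact₁ X hS x (h₂.elim _ _) rfl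
  rw [h₃.elim y 0, Ext.zero_comp]

lemma subsingleton_ext_X₃ (X : ModuleCat.{u} Aᵐᵒᵖ) {S : ShortComplex (ModuleCat.{u} Aᵐᵒᵖ)}
    (hS : S.ShortExact) (j : ℕ)
    (h₂ : Subsingleton (Ext X S.X₂ j)) (h₁ : Subsingleton (Ext X S.X₁ (j + 1))) :
    Subsingleton (Ext X S.X₃ j) := by
  refine subsingleton_of_forall_eq 0 fun x => ?_
  obtain ⟨y, rfl⟩ := Ext.covariant_sequence_exact₃ X hS x rfl (h₁.elim _ _)
  rw [h₂.elim y 0, Ext.zero_comp]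

lemma subsingleton_ext_zero_X₁ (X : ModuleCat.{u} Aᵐᵒᵖ) {S : ShortComplex (ModuleCat.{u} Aᵐᵒᵖ)}
    (hS : S.ShortExact) (h₂ : Subsingleton (Ext X S.X₂ 0)) : Subsingleton (Ext X S.X₁ 0) :=
  haveI := hS.mono_f
  ⟨fun _ _ => Ext.postcomp_mk₀_injective_of_mono X S.f (h₂.elim _ _)⟩

/-- Half exactness of `Extⁿ(DA, -)` on right modules. -/
lemma exact_extDualFunctor {S : ShortComplex (ModuleCat.{u} Aᵐᵒᵖ)} (hS : S.ShortExact) (n : ℕ) :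
    Function.Exact ((extDualFunctor k n).map S.f).hom ((extDualFunctor k n).map S.g).hom := by
  intro x
  constructor
  · intro hx
    exact Ext.covariant_sequence_exact₂ _ hS x hx
  · rintro ⟨y, rfl⟩
    exact congrArg (fun f : (extDualFunctor k n).obj S.X₁ ⟶ (extDualFunctor k n).obj S.X₃ =>
      f.hom y) (S.map (extDualFunctor k n)).zero

lemma shortExact_map_extDualFunctor {S : ShortComplex (ModuleCat.{u} Aᵐᵒᵖ)} (hS : S.ShortExact)
    (m : ℕ) (h₃ : Subsingleton (Ext (dualModule k A) S.X₃ m))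
    (h₁ : Subsingleton (Ext (dualModule k A) S.X₁ (m + 1 + 1))) :
    (S.map (extDualFunctor k (m + 1))).ShortExact := by
  refine ModuleCat.shortComplex_shortExact _ (exact_extDualFunctor hS _) ?_ ?_
  · refine (injective_iff_map_eq_zero _).2 fun x hx => ?_
    obtain ⟨y, rfl⟩ := Ext.covariant_sequence_exact₁ _ hS x hx rfl
    rw [h₃.elim y 0, Ext.zero_comp]
    rfl
  · intro x
    exact Ext.covariant_sequence_exact₃ _ hS x rfl (h₁.elim _ _)

/-- The short exact sequence `0 → Extᵐ(DA, Z) → Extᵐ⁺¹(DA, X) → Extᵐ⁺¹(DA, Y) → 0` of right modules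
coming from a short exact sequence `0 → X → Y → Z → 0`. -/
lemma shortExact_connecting {S : ShortComplex (ModuleCat.{u} Aᵐᵒᵖ)} (hS : S.ShortExact)
    (m : ℕ) (h₂ : Subsingleton (Ext (dualModule k A) S.X₂ m))
    (h₃ : Subsingleton (Ext (dualModule k A) S.X₃ (m + 1))) :
    ∃ (f : (extDualFunctor k m).obj S.X₃ ⟶ (extDualFunctor k (m + 1)).obj S.X₁)
      (w : f ≫ (extDualFunctor k (m + 1)).map S.f = 0),
      (ShortComplex.mk f ((extDualFunctor k (m + 1)).map S.f) w).ShortExact := by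
  let f : (extDualFunctor k m).obj S.X₃ ⟶ (extDualFunctor k (m + 1)).obj S.X₁ :=
    ModuleCat.ofHom (ExtDual.postcomp k hS.extClass rfl)
  have w : f ≫ (extDualFunctor k (m + 1)).map S.f = 0 := by
    ext x
    refine (Ext.comp_assoc_of_third_deg_zero (show Ext (dualModule k A) S.X₃ m from x)
      hS.extClass (Ext.mk₀ S.f) rfl).trans ?_
    rw [hS.extClass_comp, Ext.comp_zero]
    rfl
  refine ⟨f, w, ModuleCat.shortComplex_shortExact _ ?_ ?_ ?_⟩
  · intro x
    constructor
    · intro hx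
      exact Ext.covariant_sequence_exact₁ _ hS x hx rfl
    · rintro ⟨y, rfl⟩
      exact congrArg (fun f => f.hom y) w
  · refine (injective_iff_map_eq_zero _).2 fun x hx => ?_
    obtain ⟨y, rfl⟩ := Ext.covariant_sequence_exact₃ _ hS x rfl hx
    rw [h₂.elim y 0, Ext.zero_comp]
    rfl
  · intro x
    exact Ext.covariant_sequence_exact₂ _ hS x (h₃.elim _ _)

/-- In global dimension at most `n`, the kernel of an epimorphism between modules all of whose
`ν_n⁻ⁱ` are modules has the same property: `ν_n⁻¹` of the kernel has cohomology in degrees `0` and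
`1` only, and `ν_n⁻¹` of a module has no cohomology in positive degrees. The short exact sequence
therefore remains short exact under `ν_n⁻¹`. -/
lemma StaysInMod.of_shortExact {m : ℕ}
    (hgl : ∀ M : ModuleCat.{u} Aᵐᵒᵖ, HasProjectiveDimensionLT M (m + 2))
    {S : ShortComplex (ModuleCat.{u} Aᵐᵒᵖ)} (hS : S.ShortExact)
    (h₂ : StaysInMod k (m + 1) S.X₂) (h₃ : StaysInMod k (m + 1) S.X₃) :
    StaysInMod k (m + 1) S.X₁ := by
  intro i
  induction i generalizing S with
  | zero =>
    rintro (_ | j) hj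
    · exact subsingleton_ext_zero_X₁ _ hS (h₂ 0 0 hj)
    · by_cases hj' : j = m + 1
      · subst hj'
        exact HasProjectiveDimensionLT.subsingleton _ (m + 2) _ le_rfl _
      · exact subsingleton_ext_X₁ _ hS j (h₃ 0 j hj') (h₂ 0 _ hj)
  | succ i ih =>
    rw [Function.iterate_succ_apply]
    exact ih (shortExact_map_extDualFunctor hS m (h₃ 0 m (by lia))
      (HasProjectiveDimensionLT.subsingleton _ (m + 2) _ le_rfl _)) h₂.obj h₃.obj

end Concentrated

/-! ### The quotient by the idempotent -/

section Quotient

variable {A : Type u} [Ring A] (e : A)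

/-- The projection `A → A/(e)`. -/
abbrev quotMk : A →+* IdemQuot e := (TwoSidedIdeal.span {e}).ringCon.mk'

lemma quotMk_surjective : Function.Surjective (quotMk e) := RingCon.mk'_surjective _

lemma quotMk_eq_zero_iff_mem (x : A) : quotMk e x = 0 ↔ x ∈ TwoSidedIdeal.span {e} := by
  rw [TwoSidedIdeal.mem_iff, ← RingCon.eq]
  rfl

lemma quotMk_self : quotMk e e = 0 :=
  (quotMk_eq_zero_iff_mem e e).2 (TwoSidedIdeal.subset_span rfl)

variable {e}

lemma mul_mul_self_of_triangular (ht : ∀ a : A, e * a * (1 - e) = 0) (a : A) :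
    e * a * e = e * a := by
  rw [← sub_eq_zero, ← neg_eq_zero, ← ht a]
  noncomm_ring

/-- If `eA(1 - e) = 0`, then `(e) = Ae`. -/
lemma quotMk_eq_zero_iff (he : IsIdempotentElem e) (ht : ∀ a : A, e * a * (1 - e) = 0) (x : A) :
    quotMk e x = 0 ↔ x * e = x := by
  have ht' := mul_mul_self_of_triangular ht
  rw [quotMk_eq_zero_iff_mem]
  constructor
  · let I : TwoSidedIdeal A := TwoSidedIdeal.mk' {x | x * e = x} (zero_mul _)
      (fun {x y} hx hy => by
        change (x + y) * e = x + y
        rw [add_mul, show x * e = x from hx, show y * e = y from hy])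
      (fun {x} hx => by
        change -x * e = -x
        rw [neg_mul, show x * e = x from hx])
      (fun {x y} hy => by
        change x * y * e = x * y
        rw [mul_assoc, show y * e = y from hy])
      (fun {x y} hx => by
        change x * y * e = x * y
        rw [← show x * e = x from hx, mul_assoc x e y, mul_assoc x, ht'])
    have h : TwoSidedIdeal.span {e} ≤ I := TwoSidedIdeal.span_le.2 (by
      rintro _ rfl
      exact (TwoSidedIdeal.mem_mk' _ _ _ _ _ _ _).2 he)
    exact fun hx => (TwoSidedIdeal.mem_mk' {x | x * e = x} _ _ _ _ _ x).1 (h hx)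
  · intro hx
    rw [← hx]
    exact TwoSidedIdeal.mul_mem_left _ _ _ (TwoSidedIdeal.subset_span rfl)

variable (e)

/-- Restriction of scalars from right `A/(e)`-modules to right `A`-modules. -/
noncomputable abbrev restr : ModuleCat.{u} (IdemQuot e)ᵐᵒᵖ ⥤ ModuleCat.{u} Aᵐᵒᵖ :=
  ModuleCat.restrictScalars.{u} (RingHom.op (quotMk e))

lemma restr_smul (M : ModuleCat.{u} (IdemQuot e)ᵐᵒᵖ) (a : Aᵐᵒᵖ) (x : (restr e).obj M) :
    a • x = (MulOpposite.op (quotMk e a.unop) • (show M from x) : M) := rfl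

lemma restr_smul_self (M : ModuleCat.{u} (IdemQuot e)ᵐᵒᵖ) (x : (restr e).obj M) :
    MulOpposite.op e • x = 0 := by
  rw [restr_smul, MulOpposite.unop_op, quotMk_self, MulOpposite.op_zero, zero_smul]
  rfl

instance : PreservesFiniteLimits (restr e) := by
  have := ((Functor.exact_tfae (restr e)).out 1 3).mp fun S h => by
    rw [ShortComplex.ShortExact.moduleCat_exact_iff_function_exact] at h ⊢
    exact h
  exact this.1

instance : (restr e).Full where
  map_surjective {M N} g := ⟨ModuleCat.ofHom
    { toFun := fun x => (show N from g.hom (show (restr e).obj M from x))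
      map_add' := fun x y => g.hom.map_add _ _
      map_smul' := fun b x => by
        obtain ⟨a, ha⟩ := quotMk_surjective e b.unop
        have := g.hom.map_smul (MulOpposite.op a) (show (restr e).obj M from x)
        rw [restr_smul, restr_smul, MulOpposite.unop_op, ha, MulOpposite.op_unop] at this
        exact this }, rfl⟩

end Quotient

/-! ### Right modules generated by the idempotent -/

section Projective

variable {A : Type u} [Ring A] {e : A}

/-- A right module over the corner ring `eAe`, from a right `A`-module `P` with `Pe = P`. -/
noncomputable abbrev cornerModule (he : IsIdempotentElem e) (P : Type u) [AddCommGroup P]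
    [Module Aᵐᵒᵖ P] (hP : ∀ p : P, MulOpposite.op e • p = p) : Module (he.Corner)ᵐᵒᵖ P where
  smul c p := MulOpposite.op (c.unop.1) • p
  one_smul p := hP p
  mul_smul a b p := mul_smul (MulOpposite.op a.unop.1) (MulOpposite.op b.unop.1) p
  smul_zero a := smul_zero (MulOpposite.op a.unop.1)
  smul_add a := smul_add (MulOpposite.op a.unop.1)
  add_smul a b p := add_smul (MulOpposite.op a.unop.1) (MulOpposite.op b.unop.1) p
  zero_smul p := zero_smul _ p

/-- If `eA(1 - e) = 0` and `eAe` is semisimple, then each right `A`-module `P` with `Pe = P` is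
projective: it is projective over `eAe`, and `eA = eAe` is a projective right `A`-module. -/
lemma projective_of_smul_eq_self (he : IsIdempotentElem e) (ht : ∀ a : A, e * a * (1 - e) = 0)
    [IsSemisimpleRing he.Corner] (P : Type u) [AddCommGroup P] [Module Aᵐᵒᵖ P]
    (hP : ∀ p : P, MulOpposite.op e • p = p) : Module.Projective Aᵐᵒᵖ P := by
  have ht' := mul_mul_self_of_triangular ht
  let := cornerModule he P hP
  have : IsSemisimpleRing (he.Corner)ᵐᵒᵖ := isSemisimpleRing_mulOpposite_iff.2 inferInstance
  obtain ⟨s, hs⟩ := (Module.projective_def (R := (he.Corner)ᵐᵒᵖ) (P := P)).1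
    (Module.projective_of_isSemisimpleRing _ _)
  let c : (he.Corner)ᵐᵒᵖ →+ Aᵐᵒᵖ :=
    { toFun := fun x => MulOpposite.op x.unop.1
      map_zero' := rfl
      map_add' := fun _ _ => rfl }
  refine (Module.projective_def (R := Aᵐᵒᵖ) (P := P)).2
    ⟨{ toFun := fun p => Finsupp.mapRange.addMonoidHom c (s p)
       map_add' := fun p q => by rw [map_add, map_add]
       map_smul' := fun a p => ?_ }, fun p => ?_⟩
  · let a' : (he.Corner)ᵐᵒᵖ := MulOpposite.op ⟨e * a.unop * e, a.unop, rfl⟩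
    have h1 : a • p = a' • p := by
      conv_lhs => rw [← hP p, ← mul_smul]
      change _ = MulOpposite.op (e * a.unop * e) • p
      rw [ht', MulOpposite.op_mul, MulOpposite.op_unop]
    rw [h1, map_smul]
    ext i
    change c (a' * (s p) i) = a * c ((s p) i)
    obtain ⟨y, hy⟩ : ∃ y, (s p) i = MulOpposite.op y := ⟨_, rfl⟩
    have hy2 : y.1 * e = y.1 := ((Subsemigroup.mem_corner_iff he).1 y.2).2
    rw [hy]
    apply MulOpposite.unop_injective
    change y.1 * (e * a.unop * e) = y.1 * a.unop
    rw [ht', ← mul_assoc, hy2]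
  · conv_rhs => rw [← hs p]
    change Finsupp.linearCombination Aᵐᵒᵖ id (Finsupp.mapRange c c.map_zero (s p)) = _
    rw [Finsupp.linearCombination_apply, Finsupp.linearCombination_apply,
      Finsupp.sum_mapRange_index (h := fun (i : P) (a : Aᵐᵒᵖ) => a • id i)
        (fun i => zero_smul Aᵐᵒᵖ i)]
    rfl

/-- A finitely generated projective right module is a direct summand of a power of `A`. -/
lemma inAdd_of_projective (P : ModuleCat.{u} Aᵐᵒᵖ) [Module.Finite Aᵐᵒᵖ P]
    [Module.Projective Aᵐᵒᵖ P] : InAdd (ModuleCat.of Aᵐᵒᵖ A) P := by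
  obtain ⟨r, f, g, -, -, hfg⟩ := Module.Finite.exists_comp_eq_id_of_projective Aᵐᵒᵖ P
  let u : Aᵐᵒᵖ ≃ₗ[Aᵐᵒᵖ] A :=
    { MulOpposite.opAddEquiv.symm with
      map_smul' := fun _ _ => rfl }
  refine ⟨r, fun i => ModuleCat.ofHom (u.toLinearMap ∘ₗ LinearMap.proj i ∘ₗ g),
    fun i => ModuleCat.ofHom
      (f ∘ₗ LinearMap.single Aᵐᵒᵖ (fun _ => Aᵐᵒᵖ) i ∘ₗ u.symm.toLinearMap), ?_⟩
  ext p
  have : f (∑ i, Pi.single i (g p i)) = p := by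
    rw [Finset.univ_sum_single]
    exact LinearMap.congr_fun hfg p
  rw [map_sum] at this
  simpa [ModuleCat.hom_sum] using this

end Projective

/-! ### Comparison of `Ext` over the algebra and over the quotient -/

section ExtComparison

/-- An exact fully faithful functor induces bijections on `Ext` when each object is a quotient of a
projective object whose image has no higher extensions with objects in the image. -/
lemma mapExt_bijective_of_acyclic {C D : Type*} [Category* C] [Abelian C] [Category* D] [Abelian D]
    [HasExt.{u} C] [HasExt.{u} D] (F : C ⥤ D) [F.Additive] [PreservesFiniteLimits F]
    [PreservesFiniteColimits F] [F.Full] [F.Faithful]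
    (hF : ∀ X : C, ∃ (P : C) (f : P ⟶ X), Epi f ∧ Projective P ∧
      ∀ (Y : C) (n : ℕ), Subsingleton (Ext (F.obj P) (F.obj Y) (n + 1)))
    (X Y : C) (n : ℕ) : Function.Bijective (F.mapExtAddHom X Y n) := by
  induction n generalizing X with
  | zero =>
    simpa [Ext.mapExactFunctor₀] using ⟨Functor.Faithful.map_injective, Functor.Full.map_surjective⟩
  | succ n hn =>
    obtain ⟨P, f, _, _, hP⟩ := hF X
    let S := ShortComplex.mk _ _ (kernel.condition f)
    have hS : S.ShortExact := { exact := ShortComplex.exact_kernel f }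
    have h₂ : Projective S.X₂ := ‹Projective P›
    exact AddMonoidHom.bijective_of_surjective_of_bijective_of_right_exact _ _ _ _
      (F.mapExtAddHom S.X₂ Y n) (F.mapExtAddHom S.X₁ Y n) (F.mapExtAddHom S.X₃ Y (n + 1))
      (by ext; simp [Ext.mapExactFunctor_comp, Ext.mapExactFunctor_mk₀]; rfl)
      (by ext; simp [Ext.mapExactFunctor_comp, Ext.mapExactFunctor_extClass]; rfl)
      ((ShortComplex.ab_exact_iff_function_exact _).1
        (Ext.contravariant_sequence_exact₁' hS Y n (n + 1) (add_comm 1 n)))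
      ((ShortComplex.ab_exact_iff_function_exact _).1
        (Ext.contravariant_sequence_exact₁' (hS.map_of_exact F) (F.obj Y) n (n + 1)
          (add_comm 1 n)))
      (hn _).surjective (hn _)
      (fun x₃ => Ext.contravariant_sequence_exact₃ hS _ x₃ (Ext.eq_zero_of_projective _)
        (add_comm 1 n))
      (fun y₃ => Ext.contravariant_sequence_exact₃ (hS.map_of_exact F) _ y₃
        ((hP Y n).elim _ _) (add_comm 1 n))

variable {A : Type u} [Ring A] {e : A}

/-- A free right `A/(e)`-module has no higher extensions by `A/(e)`-modules over `A`: it has a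
projective resolution `0 → K → F → P → 0` with `Ke = K`, so that `Hom(K, N) = 0` when `Ne = 0`. -/
lemma subsingleton_ext_restr_free (he : IsIdempotentElem e) (ht : ∀ a : A, e * a * (1 - e) = 0)
    [IsSemisimpleRing he.Corner] (ι : Type u) (N : ModuleCat.{u} (IdemQuot e)ᵐᵒᵖ) (n : ℕ) :
    Subsingleton (Ext ((restr e).obj (ModuleCat.of (IdemQuot e)ᵐᵒᵖ (ι →₀ (IdemQuot e)ᵐᵒᵖ)))
      ((restr e).obj N) (n + 1)) := by
  let c : Aᵐᵒᵖ →+ (IdemQuot e)ᵐᵒᵖ := (RingHom.op (quotMk e)).toAddMonoidHom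
  let f : (ι →₀ Aᵐᵒᵖ) →ₗ[Aᵐᵒᵖ]
      (restr e).obj (ModuleCat.of (IdemQuot e)ᵐᵒᵖ (ι →₀ (IdemQuot e)ᵐᵒᵖ)) :=
    { toFun := fun v => Finsupp.mapRange.addMonoidHom c v
      map_add' := fun v w => map_add _ v w
      map_smul' := fun a v => by
        refine Finsupp.ext fun i => ?_
        exact map_mul (RingHom.op (quotMk e)) a (v i) }
  have hf : Function.Surjective f := Finsupp.mapRange_surjective c c.map_zero fun b => by
    obtain ⟨a, ha⟩ := quotMk_surjective e b.unop
    exact ⟨MulOpposite.op a, MulOpposite.unop_injective ha⟩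
  have hker (v : LinearMap.ker f) : MulOpposite.op e • v = v := by
    refine Subtype.ext (Finsupp.ext fun i => MulOpposite.unop_injective ?_)
    refine (quotMk_eq_zero_iff he ht _).1 ?_
    exact congrArg MulOpposite.unop (DFunLike.congr_fun (show Finsupp.mapRange c c.map_zero v.1 = 0
      from v.2) i)
  let S : ShortComplex (ModuleCat.{u} Aᵐᵒᵖ) := f.shortComplexKer
  have hS : S.ShortExact := LinearMap.shortExact_shortComplexKer hf
  have : Projective S.X₂ := ModuleCat.projective_of_free (Module.Free.chooseBasis Aᵐᵒᵖ (ι →₀ Aᵐᵒᵖ))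
  have : Projective S.X₁ := by
    have := projective_of_smul_eq_self he ht (LinearMap.ker f) hker
    exact (IsProjective.iff_projective (R := Aᵐᵒᵖ) (LinearMap.ker f)).1 this
  refine subsingleton_of_forall_eq 0 fun x => ?_
  obtain ⟨y, rfl⟩ := Ext.contravariant_sequence_exact₃ hS _ x (Ext.eq_zero_of_projective _)
    (add_comm 1 n)
  rcases n with _ | n
  · obtain ⟨φ, rfl⟩ := (Ext.mk₀_bijective _ _).2 y
    have : φ = 0 := by
      ext v
      have := φ.hom.map_smul (MulOpposite.op e) v
      rw [restr_smul_self] at this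
      rw [hker v] at this
      exact this
    rw [this, Ext.mk₀_zero, Ext.comp_zero]
  · rw [Ext.eq_zero_of_projective y, Ext.comp_zero]

/-- Extensions of right `A/(e)`-modules are the same over `A` and over `A/(e)`. -/
lemma mapExt_restr_bijective (he : IsIdempotentElem e) (ht : ∀ a : A, e * a * (1 - e) = 0)
    [IsSemisimpleRing he.Corner] (M N : ModuleCat.{u} (IdemQuot e)ᵐᵒᵖ) (n : ℕ) :
    Function.Bijective ((restr e).mapExtAddHom M N n) := by
  refine mapExt_bijective_of_acyclic (restr e) (fun X => ?_) M N n
  refine ⟨ModuleCat.of _ (X →₀ (IdemQuot e)ᵐᵒᵖ),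
    ModuleCat.ofHom (Finsupp.linearCombination (IdemQuot e)ᵐᵒᵖ id), ?_, ?_,
    fun Y n => subsingleton_ext_restr_free he ht X Y n⟩
  · rw [ModuleCat.epi_iff_surjective]
    exact Finsupp.linearCombination_id_surjective _ _
  · exact ModuleCat.projective_of_free (Module.Free.chooseBasis _ (X →₀ (IdemQuot e)ᵐᵒᵖ))

end ExtComparison

/-! ### The dual of the quotient as a direct summand of the dual -/

section Dual

variable (k : Type u) {A : Type u} [Field k] [Ring A] [Algebra k A] {e : A}

variable (e) in
/-- The projection `A → A/(e)` as a `k`-linear map. -/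
def quotMkLinear : A →ₗ[k] IdemQuot e where
  toFun := quotMk e
  map_add' := map_add _
  map_smul' _ _ := rfl

variable (e) in
/-- The inclusion `D(A/(e)) → DA`, the dual of the projection `A → A/(e)`. -/
noncomputable def dualIncl : (restr e).obj (dualModule k (IdemQuot e)) ⟶ dualModule k A :=
  ModuleCat.ofHom (X := (restr e).obj (dualModule k (IdemQuot e))) (Y := DualAlg k A)
    { toFun := fun g => (show IdemQuot e →ₗ[k] k from g) ∘ₗ quotMkLinear k e
      map_add' := fun _ _ => rfl
      map_smul' := fun _ _ => rfl }

lemma ker_quotMkLinear_le (he : IsIdempotentElem e) (ht : ∀ a : A, e * a * (1 - e) = 0)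
    (g : A →ₗ[k] k) :
    LinearMap.ker (quotMkLinear k e) ≤ LinearMap.ker (g ∘ₗ LinearMap.mulRight k (1 - e)) := by
  intro x hx
  have hx : x * e = x := (quotMk_eq_zero_iff he ht x).1 hx
  have : x * (1 - e) = 0 := by rw [mul_sub, hx, mul_one, sub_self]
  exact (congrArg g this).trans (map_zero _)

/-- The functional `x ↦ g(x(1 - e))` on `A/(e)` for `g ∈ DA`. -/
noncomputable def dualProjFun (he : IsIdempotentElem e) (ht : ∀ a : A, e * a * (1 - e) = 0)
    (g : DualAlg k A) : DualAlg k (IdemQuot e) :=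
  show IdemQuot e →ₗ[k] k from
  (LinearMap.ker (quotMkLinear k e)).liftQ
    ((show A →ₗ[k] k from g) ∘ₗ LinearMap.mulRight k (1 - e)) (ker_quotMkLinear_le k he ht g) ∘ₗ
    ((quotMkLinear k e).quotKerEquivOfSurjective (quotMk_surjective e)).symm.toLinearMap

lemma dualProjFun_eval (he : IsIdempotentElem e) (ht : ∀ a : A, e * a * (1 - e) = 0)
    (g : DualAlg k A) (x : A) :
    (dualProjFun k he ht g).eval (quotMk e x) = g.eval (x * (1 - e)) := by
  have h : ((quotMkLinear k e).quotKerEquivOfSurjective (quotMk_surjective e)).symm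
      (quotMkLinear k e x) = Submodule.Quotient.mk x := by
    rw [LinearEquiv.symm_apply_eq]
    rfl
  exact congrArg (Submodule.liftQ (LinearMap.ker (quotMkLinear k e)) _
    (ker_quotMkLinear_le k he ht g)) h

lemma dualAlg_idemQuot_ext {f g : DualAlg k (IdemQuot e)}
    (h : ∀ x : A, f.eval (quotMk e x) = g.eval (quotMk e x)) : f = g :=
  DualAlg.ext fun y => by
    obtain ⟨x, rfl⟩ := quotMk_surjective e y
    exact h x

/-- The retraction `DA → D(A/(e))` with image `(1 - e)DA`. -/
noncomputable def dualProj (he : IsIdempotentElem e) (ht : ∀ a : A, e * a * (1 - e) = 0) :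
    dualModule k A ⟶ (restr e).obj (dualModule k (IdemQuot e)) :=
  ModuleCat.ofHom (X := DualAlg k A) (Y := (restr e).obj (dualModule k (IdemQuot e)))
    { toFun := fun g => dualProjFun k he ht g
      map_add' := fun f g => dualAlg_idemQuot_ext k fun x => by
        refine (dualProjFun_eval k he ht _ x).trans ?_
        refine Eq.trans ?_ (congrArg₂ (· + ·) (dualProjFun_eval k he ht f x)
          (dualProjFun_eval k he ht g x)).symm
        rfl
      map_smul' := fun a g => dualAlg_idemQuot_ext k fun x => by
        refine (dualProjFun_eval k he ht _ x).trans ?_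
        refine Eq.trans ?_ (dualProjFun_eval k he ht g (a.unop * x)).symm
        exact congrArg g.eval (mul_assoc _ _ _).symm }

lemma dualIncl_dualProj (he : IsIdempotentElem e) (ht : ∀ a : A, e * a * (1 - e) = 0) :
    dualIncl k e ≫ dualProj k he ht = 𝟙 _ := by
  ext g
  refine dualAlg_idemQuot_ext k fun x => (dualProjFun_eval k he ht _ x).trans ?_
  refine congrArg (DualAlg.eval (show DualAlg k (IdemQuot e) from g)) ?_
  change quotMk e (x * (1 - e)) = quotMk e x
  rw [map_mul, map_sub, map_one, quotMk_self, sub_zero, mul_one]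

lemma dualProj_dualIncl (he : IsIdempotentElem e) (ht : ∀ a : A, e * a * (1 - e) = 0) :
    dualProj k he ht ≫ dualIncl k e = leftMulHom k (1 - e) := by
  ext g x
  exact dualProjFun_eval k he ht g x

lemma dualIncl_leftMulHom (a : A) :
    (restr e).map (leftMulHom k (quotMk e a)) ≫ dualIncl k e = dualIncl k e ≫ leftMulHom k a := rfl

end Dual

/-! ### Comparison of `Ext(DA, -)` over the algebra and over the quotient -/

section Comparison

variable (k : Type u) {A : Type u} [Field k] [Ring A] [Algebra k A] {e : A}

/-- For a right `A/(e)`-module `M`, the map `Extⁿ_A(DA, M) → Extⁿ_{A/(e)}(D(A/(e)), M)`: restriction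
along `D(A/(e)) → DA`, followed by the identification of the extensions over `A` with those over
`A/(e)`. -/
noncomputable def extDualComparison (he : IsIdempotentElem e) (ht : ∀ a : A, e * a * (1 - e) = 0)
    [IsSemisimpleRing he.Corner] (M : ModuleCat.{u} (IdemQuot e)ᵐᵒᵖ) (n : ℕ) :
    Ext (dualModule k A) ((restr e).obj M) n →+ Ext (dualModule k (IdemQuot e)) M n :=
  (AddEquiv.ofBijective ((restr e).mapExtAddHom _ _ n)
    (mapExt_restr_bijective he ht _ M n)).symm.toAddMonoidHom.comp
    (AddMonoidHom.mk' (fun x => (Ext.mk₀ (dualIncl k e)).comp x (zero_add n))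
      fun _ _ => Ext.comp_add ..)

lemma mapExt_extDualComparison (he : IsIdempotentElem e) (ht : ∀ a : A, e * a * (1 - e) = 0)
    [IsSemisimpleRing he.Corner] (M : ModuleCat.{u} (IdemQuot e)ᵐᵒᵖ) (n : ℕ)
    (x : Ext (dualModule k A) ((restr e).obj M) n) :
    (extDualComparison k he ht M n x).mapExactFunctor (restr e) =
      (Ext.mk₀ (dualIncl k e)).comp x (zero_add n) :=
  (AddEquiv.ofBijective ((restr e).mapExtAddHom _ _ n)
    (mapExt_restr_bijective he ht _ M n)).apply_symm_apply _

lemma extDualComparison_leftMulHom (he : IsIdempotentElem e)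
    (ht : ∀ a : A, e * a * (1 - e) = 0) [IsSemisimpleRing he.Corner]
    (M : ModuleCat.{u} (IdemQuot e)ᵐᵒᵖ) (n : ℕ) (a : A)
    (x : Ext (dualModule k A) ((restr e).obj M) n) :
    extDualComparison k he ht M n ((Ext.mk₀ (leftMulHom k a)).comp x (zero_add n)) =
      (Ext.mk₀ (leftMulHom k (quotMk e a))).comp (extDualComparison k he ht M n x)
        (zero_add n) := by
  refine (mapExt_restr_bijective he ht _ M n).injective ?_
  change Ext.mapExactFunctor (restr e) _ = Ext.mapExactFunctor (restr e) _
  rw [mapExt_extDualComparison, Ext.mapExactFunctor_comp, mapExt_extDualComparison,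
    Ext.mapExactFunctor_mk₀, Ext.mk₀_comp_mk₀_assoc, Ext.mk₀_comp_mk₀_assoc, dualIncl_leftMulHom]

lemma extDualComparison_surjective (he : IsIdempotentElem e)
    (ht : ∀ a : A, e * a * (1 - e) = 0) [IsSemisimpleRing he.Corner]
    (M : ModuleCat.{u} (IdemQuot e)ᵐᵒᵖ) (n : ℕ) :
    Function.Surjective (extDualComparison k he ht M n) := fun y => by
  refine ⟨(Ext.mk₀ (dualProj k he ht)).comp (y.mapExactFunctor (restr e)) (zero_add n),
    (mapExt_restr_bijective he ht _ M n).injective ?_⟩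
  change Ext.mapExactFunctor (restr e) _ = Ext.mapExactFunctor (restr e) _
  rw [mapExt_extDualComparison, Ext.mk₀_comp_mk₀_assoc, dualIncl_dualProj, Ext.mk₀_id_comp]

lemma leftMulHom_comp_of_extDualComparison_eq_zero (he : IsIdempotentElem e)
    (ht : ∀ a : A, e * a * (1 - e) = 0) [IsSemisimpleRing he.Corner]
    (M : ModuleCat.{u} (IdemQuot e)ᵐᵒᵖ) (n : ℕ) (x : Ext (dualModule k A) ((restr e).obj M) n)
    (hx : extDualComparison k he ht M n x = 0) :
    (Ext.mk₀ (leftMulHom k (1 - e))).comp x (zero_add n) = 0 := by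
  rw [← dualProj_dualIncl k he ht, ← Ext.mk₀_comp_mk₀_assoc, ← mapExt_extDualComparison k he ht, hx,
    Ext.mapExactFunctor_zero, Ext.comp_zero]

/-- The comparison of `Extⁿ_A(DA, M)` with `Extⁿ_{A/(e)}(D(A/(e)), M)` is a surjective map of right
`A`-modules, and `e` acts as the identity on its kernel. -/
lemma exists_extDual_comparison (he : IsIdempotentElem e) (ht : ∀ a : A, e * a * (1 - e) = 0)
    [IsSemisimpleRing he.Corner] (M : ModuleCat.{u} (IdemQuot e)ᵐᵒᵖ) (n : ℕ) :
    ∃ θ : (extDualFunctor k n).obj ((restr e).obj M) ⟶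
        (restr e).obj ((extDualFunctor k n).obj M),
      Function.Surjective θ.hom ∧ ∀ x, θ.hom x = 0 → MulOpposite.op e • x = x := by
  refine ⟨ModuleCat.ofHom (X := ExtDual k ((restr e).obj M) n)
    (Y := (restr e).obj ((extDualFunctor k n).obj M))
    { toFun := fun x => extDualComparison k he ht M n x
      map_add' := fun x y => map_add (extDualComparison k he ht M n) x y
      map_smul' := fun a x => extDualComparison_leftMulHom k he ht M n a.unop x },
    extDualComparison_surjective k he ht M n, fun x hx => ?_⟩
  have h : MulOpposite.op (1 - e) • x = 0 :=
    leftMulHom_comp_of_extDualComparison_eq_zero k he ht M n x hx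
  rw [MulOpposite.op_sub, sub_smul, MulOpposite.op_one, one_smul, sub_eq_zero] at h
  exact h.symm

end Comparison

/-! ### Homological dimensions of the quotient -/

section Dimension

lemma InAdd.hasInjectiveDimensionLT {C : Type*} [Category* C] [Abelian C] {X Y : C}
    (h : InAdd X Y) (n : ℕ) (hX : HasInjectiveDimensionLT X n) : HasInjectiveDimensionLT Y n := by
  have := HasExt.standard C
  obtain ⟨r, π, σ, h⟩ := h
  refine HasInjectiveDimensionLT.mk fun i hi Z x => ?_
  rw [← Ext.comp_mk₀_id x, ← h, Ext.mk₀_sum, Ext.comp_sum]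
  refine Finset.sum_eq_zero fun j _ => ?_
  rw [← Ext.mk₀_comp_mk₀, ← Ext.comp_assoc_of_second_deg_zero,
    Ext.eq_zero_of_hasInjectiveDimensionLT (x.comp (Ext.mk₀ (π j)) (add_zero i)) n hi,
    Ext.zero_comp]

variable {A : Type u} [Ring A] {e : A} {m : ℕ}

/-- The functors `Extᵐ⁺¹(Y, -)` are right exact, so that the bound on the injective dimension of
`A/(e)` passes to its finitely generated modules. -/
lemma hasInjectiveDimensionLT_restr
    (hgl : ∀ M : ModuleCat.{u} Aᵐᵒᵖ, HasProjectiveDimensionLT M (m + 2))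
    (hid : HasInjectiveDimensionLT (idemQuotModule e) (m + 1))
    (N : ModuleCat.{u} (IdemQuot e)ᵐᵒᵖ) [Module.Finite (IdemQuot e)ᵐᵒᵖ N] :
    HasInjectiveDimensionLT ((restr e).obj N) (m + 1) := by
  obtain ⟨r, f, hf⟩ := Module.Finite.exists_fin' (IdemQuot e)ᵐᵒᵖ N
  let S : ShortComplex (ModuleCat.{u} (IdemQuot e)ᵐᵒᵖ) := f.shortComplexKer
  have hS : (S.map (restr e)).ShortExact :=
    (LinearMap.shortExact_shortComplexKer hf).map_of_exact (restr e)
  have h₂ : HasInjectiveDimensionLT ((restr e).obj S.X₂) (m + 1) :=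
    ((inAdd_of_projective (ModuleCat.of (IdemQuot e)ᵐᵒᵖ (Fin r → (IdemQuot e)ᵐᵒᵖ))).map
      (restr e)).hasInjectiveDimensionLT _ hid
  refine hasInjectiveDimensionLT_of_enoughProjectives _ _ fun Y => ?_
  exact subsingleton_ext_X₃ Y hS (m + 1)
    (HasInjectiveDimensionLT.subsingleton ((restr e).obj S.X₂) (m + 1) _ le_rfl Y)
    (HasProjectiveDimensionLT.subsingleton Y (m + 2) _ le_rfl _)

lemma hasProjectiveDimensionLT_idemQuot (he : IsIdempotentElem e)
    (ht : ∀ a : A, e * a * (1 - e) = 0) [IsSemisimpleRing he.Corner]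
    [IsNoetherianRing (IdemQuot e)ᵐᵒᵖ]
    (hgl : ∀ M : ModuleCat.{u} Aᵐᵒᵖ, HasProjectiveDimensionLT M (m + 2))
    (hid : HasInjectiveDimensionLT (idemQuotModule e) (m + 1))
    (M : ModuleCat.{u} (IdemQuot e)ᵐᵒᵖ) : HasProjectiveDimensionLT M (m + 1) := by
  refine hasProjectiveDimensionLT_of_ext_finite m (fun M N _ _ => ?_) M
  have := hasInjectiveDimensionLT_restr hgl hid N
  have := HasInjectiveDimensionLT.subsingleton ((restr e).obj N) (m + 1) _ le_rfl ((restr e).obj M)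
  exact (mapExt_restr_bijective he ht M N (m + 1)).injective.subsingleton

end Dimension

/-! ### The inductive step -/

section Cover

variable (k : Type u) {A : Type u} [Field k] [Ring A] [Algebra k A] {e : A} {m : ℕ}

/-- A right `A/(e)`-module `M` is covered if it has a presentation `0 → P → X → M → 0` over `A` in
which `P` is a direct summand of a power of `A`, the module `X` is finitely generated, and all
`ν_n⁻ⁱ X` are modules. -/
def IsCovered (n : ℕ) (M : ModuleCat.{u} (IdemQuot e)ᵐᵒᵖ) : Prop :=
  ∃ (P X : ModuleCat.{u} Aᵐᵒᵖ) (f : P ⟶ X) (g : X ⟶ (restr e).obj M) (w : f ≫ g = 0),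
    (ShortComplex.mk f g w).ShortExact ∧ InAdd (ModuleCat.of Aᵐᵒᵖ A) P ∧
    Module.Finite Aᵐᵒᵖ X ∧ StaysInMod k n X

variable {k}

lemma IsCovered.of_surjective (he : IsIdempotentElem e) (ht : ∀ a : A, e * a * (1 - e) = 0)
    [IsSemisimpleRing he.Corner] [IsNoetherianRing Aᵐᵒᵖ] {n : ℕ}
    {M : ModuleCat.{u} (IdemQuot e)ᵐᵒᵖ} {X : ModuleCat.{u} Aᵐᵒᵖ} [Module.Finite Aᵐᵒᵖ X]
    (hX : StaysInMod k n X) (g : X ⟶ (restr e).obj M) (hg : Function.Surjective g.hom)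
    (hker : ∀ x, g.hom x = 0 → MulOpposite.op e • x = x) : IsCovered k n M := by
  have : Module.Projective Aᵐᵒᵖ (LinearMap.ker g.hom) :=
    projective_of_smul_eq_self he ht _ fun x => Subtype.ext (hker x.1 x.2)
  exact ⟨ModuleCat.of Aᵐᵒᵖ (LinearMap.ker g.hom), X, _, g, _,
    LinearMap.shortExact_shortComplexKer hg, inAdd_of_projective _, inferInstance, hX⟩

lemma IsCovered.finite {n : ℕ} {M : ModuleCat.{u} (IdemQuot e)ᵐᵒᵖ} (h : IsCovered k n M) :
    Module.Finite (IdemQuot e)ᵐᵒᵖ M := by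
  obtain ⟨P, X, f, g, w, hS, -, _, -⟩ := h
  have := hS.epi_g
  have hg : Function.Surjective g.hom := (ModuleCat.epi_iff_surjective g).1 this
  have : RingHomSurjective (RingHom.op (quotMk e)) := ⟨fun b => by
    obtain ⟨a, ha⟩ := quotMk_surjective e b.unop
    exact ⟨MulOpposite.op a, MulOpposite.unop_injective ha⟩⟩
  let g' : X →ₛₗ[RingHom.op (quotMk e)] M :=
    { toFun := g.hom
      map_add' := g.hom.map_add
      map_smul' := g.hom.map_smul }
  exact Module.Finite.of_surjective g' hg

/-- If `M` is covered, then so is `Extᵐ(D(A/(e)), M)` over `A/(e)`, and `Ext(D(A/(e)), M)` is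
concentrated in degree `m`. -/
lemma IsCovered.step (he : IsIdempotentElem e) (ht : ∀ a : A, e * a * (1 - e) = 0)
    [IsSemisimpleRing he.Corner] [IsNoetherianRing Aᵐᵒᵖ]
    (hgl : ∀ M : ModuleCat.{u} Aᵐᵒᵖ, HasProjectiveDimensionLT M (m + 2))
    (hid : HasInjectiveDimensionLT (idemQuotModule e) (m + 1))
    (hA : StaysInMod k (m + 1) (ModuleCat.of Aᵐᵒᵖ A))
    (hfin : Module.Finite Aᵐᵒᵖ ((extDualFunctor k (m + 1)).obj (ModuleCat.of Aᵐᵒᵖ A)))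
    {M : ModuleCat.{u} (IdemQuot e)ᵐᵒᵖ} (hM : IsCovered k (m + 1) M) :
    ExtConcentrated k m M ∧ IsCovered k (m + 1) ((extDualFunctor k m).obj M) := by
  have := hM.finite
  have hidM := hasInjectiveDimensionLT_restr hgl hid M
  obtain ⟨P, X, f, g, w, hS, hP, _, hX⟩ := hM
  have hPs := hA.of_inAdd hP
  constructor
  · intro j hj
    have hj' : Subsingleton (Ext (dualModule k A) ((restr e).obj M) j) := by
      by_cases h : m + 1 ≤ j
      · exact HasInjectiveDimensionLT.subsingleton ((restr e).obj M) (m + 1) j h _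
      · exact subsingleton_ext_X₃ _ hS j (hX 0 j (by lia)) (hPs 0 (j + 1) (by lia))
    obtain ⟨θ, hθ, -⟩ := exists_extDual_comparison k he ht M j
    have : Subsingleton ((extDualFunctor k j).obj ((restr e).obj M)) := hj'
    exact hθ.subsingleton
  · obtain ⟨f', w', hS'⟩ := shortExact_connecting (k := k) hS m (hX 0 m (by lia))
      (HasInjectiveDimensionLT.subsingleton ((restr e).obj M) (m + 1) _ le_rfl _)
    have hK : StaysInMod k (m + 1) ((extDualFunctor k m).obj ((restr e).obj M)) :=
      StaysInMod.of_shortExact hgl hS' hPs.obj hX.obj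
    have hfP : Module.Finite Aᵐᵒᵖ ((extDualFunctor k (m + 1)).obj P) :=
      (hP.map (extDualFunctor k (m + 1))).finite
    have hmono := hS'.mono_f
    have : Module.Finite Aᵐᵒᵖ ((extDualFunctor k m).obj ((restr e).obj M)) :=
      Module.Finite.of_injective f'.hom ((ModuleCat.mono_iff_injective f').1 hmono)
    obtain ⟨θ, hθ, hker⟩ := exists_extDual_comparison k he ht M m
    exact IsCovered.of_surjective he ht hK θ hθ hker

/-- The module `A/(e)` is covered by the presentation `0 → Ae → A → A/(e) → 0`. -/
lemma isCovered_idemQuot (he : IsIdempotentElem e) (ht : ∀ a : A, e * a * (1 - e) = 0)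
    [IsSemisimpleRing he.Corner] [IsNoetherianRing Aᵐᵒᵖ] [Module.Finite Aᵐᵒᵖ A] {n : ℕ}
    (hA : StaysInMod k n (ModuleCat.of Aᵐᵒᵖ A)) :
    IsCovered k n (ModuleCat.of (IdemQuot e)ᵐᵒᵖ (IdemQuot e)) := by
  let g : ModuleCat.of Aᵐᵒᵖ A ⟶ (restr e).obj (ModuleCat.of (IdemQuot e)ᵐᵒᵖ (IdemQuot e)) :=
    ModuleCat.ofHom (X := A) (Y := (restr e).obj (ModuleCat.of (IdemQuot e)ᵐᵒᵖ (IdemQuot e)))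
      { toFun := fun x => quotMk e x
        map_add' := fun x y => map_add (quotMk e) x y
        map_smul' := fun a x => map_mul (quotMk e) x a.unop }
  have : Module.Finite Aᵐᵒᵖ (ModuleCat.of Aᵐᵒᵖ A) := ‹Module.Finite Aᵐᵒᵖ A›
  exact IsCovered.of_surjective he ht hA g (quotMk_surjective e)
    fun x hx => (quotMk_eq_zero_iff he ht x).1 hx

end Cover

/-! ### Representation infinite quotients -/

lemma isNoetherianRing_mulOpposite (k A : Type u) [Field k] [Ring A] [Algebra k A]
    [FiniteDimensional k A] : IsNoetherianRing Aᵐᵒᵖ :=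
  isNoetherian_of_tower k (isNoetherian_of_isNoetherianRing_of_finite k Aᵐᵒᵖ)

end RepInf

open RepInf in
theorem theorem2p3 {k A : Type u} [Field k] [Ring A] [Algebra k A] (d : ℕ) (hd : 1 ≤ d)
    (hA : RepInf.IsRepresentationInfinite k A d) (e : A) (he : IsIdempotentElem e)
    (h_triangular : ∀ a : A, e * a * (1 - e) = 0)
    (h_id : CategoryTheory.injectiveDimension (RepInf.idemQuotModule e) < d)
    (h_semisimple : IsSemisimpleRing he.Corner) :
    RepInf.IsRepresentationInfinite k (RepInf.IdemQuot e) (d - 1) := by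
  obtain ⟨m, rfl⟩ : ∃ m, d = m + 1 := ⟨d - 1, by lia⟩
  rw [Nat.add_sub_cancel]
  have := hA.finiteDimensional
  have hB : FiniteDimensional k (IdemQuot e) :=
    Module.Finite.of_surjective (quotMkLinear k e) (quotMk_surjective e)
  have := isNoetherianRing_mulOpposite k A
  have := isNoetherianRing_mulOpposite k (IdemQuot e)
  have hgl (M : ModuleCat.{u} Aᵐᵒᵖ) : HasProjectiveDimensionLT M (m + 2) :=
    (projectiveDimension_le_iff M (m + 1)).1 (hA.globalDimension_le M)
  have hid : HasInjectiveDimensionLT (idemQuotModule e) (m + 1) :=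
    injectiveDimension_lt_iff.1 h_id
  have hpow := (nuInvPow_isInMod_iff k A (m + 1)).1 hA.nuInvPow_isInMod
  have hstay : StaysInMod k (m + 1) (ModuleCat.of Aᵐᵒᵖ A) := fun i => (hpow i).2
  have hcov (i : ℕ) : IsCovered k (m + 1) ((extDualFunctor k m).obj^[i]
      (ModuleCat.of (IdemQuot e)ᵐᵒᵖ (IdemQuot e))) := by
    induction i with
    | zero =>
      have : Module.Finite Aᵐᵒᵖ A := (hpow 0).1
      exact isCovered_idemQuot he h_triangular hstay
    | succ i ih =>
      rw [Function.iterate_succ_apply']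
      exact (ih.step he h_triangular hgl hid hstay (hpow 1).1).2
  refine ⟨hB, fun M => ?_, (nuInvPow_isInMod_iff k (IdemQuot e) m).2 fun i =>
    ⟨(hcov i).finite, ((hcov i).step he h_triangular hgl hid hstay (hpow 1).1).1⟩⟩
  exact (projectiveDimension_le_iff M m).2
    (hasProjectiveDimensionLT_idemQuot he h_triangular hgl hid M)
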